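/- Let $I,J\subset\mathbb R$ be non-empty open intervals and let $f:I\to\mathbb R$, $g:J\to\mathbb R$ be smooth ($C^\infty$). Let $S=\{(x,y,f(x)g(y)) : x\in I,\ y\in J\}\subset\mathbb R^3$ be the corresponding homothetical surface, i.e. the graph of $z(x,y)=f(x)g(y)$, and suppose that its Gauss curvature is constant, equal to $K$. Then $K=0$. Furthermore, at least one of the following holds: 1. $S$ is a cylindrical surface over a plane curve, that is, $S=\{\alpha(t)+s\,w : t\in T,\ s\in R\}$ for open intervals $T,R$, a smooth regular curve $\alpha:T\to\mathbb R^3$ contained in a plane $P$, and a fixed vector $w$ not parallel to $P$; 2. $z(x,y)=a\,e^{bx+cy}$ on $I\times J$, with constants $a,b,c\in\mathbb R$, $a,b,c\neq 0$; 3. on $I\times J$, $$z(x,y)=\pm\left(\frac{bx}{m}+d\right)^{m}\left(\frac{cy}{m-1}+e\right)^{1-m}$$ with a fixed sign and constants $b,c,d,e,m\in\mathbb R$, $b,c\neq 0$, $m\neq 0,1$, where the powers make sense: if $m$ is not an integer, both bases are positive on $I$ and $J$, and if $m$ is an integer, the base carrying the negative exponent (exactly one of $m$, $1-m$ is negative)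 does not vanish. -/

import Mathlib

open scoped ContDiff

noncomputable section

/-- Euclidean three-space. -/
abbrev E3 : Type := EuclideanSpace ℝ (Fin 3)

namespace ParamSurface

/-- First partial derivative in the first variable of a parametrization `X(u, v)`. -/
def du (X : ℝ → ℝ → E3) : ℝ → ℝ → E3 := fun u v => deriv (fun s => X s v) u

/-- First partial derivative in the second variable. -/
def dv (X : ℝ → ℝ → E3) : ℝ → ℝ → E3 := fun u v => deriv (fun t => X u t) v

/-- The (not normalized) normal `X_u × X_v`. -/
def normal (X : ℝ → ℝ → E3) (u v : ℝ) : E3 :=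
  WithLp.toLp 2 (crossProduct (WithLp.ofLp (du X u v)) (WithLp.ofLp (dv X u v)))

/-- The unit normal `(X_u × X_v) / ‖X_u × X_v‖`. -/
def unitNormal (X : ℝ → ℝ → E3) (u v : ℝ) : E3 := ‖normal X u v‖⁻¹ • normal X u v

/-- Coefficients of the first fundamental form. -/
def coeffE (X : ℝ → ℝ → E3) (u v : ℝ) : ℝ := inner ℝ (du X u v) (du X u v)

def coeffF (X : ℝ → ℝ → E3) (u v : ℝ) : ℝ := inner ℝ (du X u v) (dv X u v)

def coeffG (X : ℝ → ℝ → E3) (u v : ℝ) : ℝ := inner ℝ (dv X u v) (dv X u v)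

/-- Coefficients of the second fundamental form. -/
def coeffl (X : ℝ → ℝ → E3) (u v : ℝ) : ℝ := inner ℝ (du (du X) u v) (unitNormal X u v)

def coeffm (X : ℝ → ℝ → E3) (u v : ℝ) : ℝ := inner ℝ (dv (du X) u v) (unitNormal X u v)

def coeffn (X : ℝ → ℝ → E3) (u v : ℝ) : ℝ := inner ℝ (dv (dv X) u v) (unitNormal X u v)

/-- The Gauss curvature `K = (l n - m²) / (E G - F²)`. -/
def gaussCurvature (X : ℝ → ℝ → E3) (u v : ℝ) : ℝ :=
  (coeffl X u v * coeffn X u v - coeffm X u v ^ 2) /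
    (coeffE X u v * coeffG X u v - coeffF X u v ^ 2)

end ParamSurface

/-- The parametrization `X(x, y) = (x, y, f(x) g(y))`. -/
def homotheticalParam (f g : ℝ → ℝ) : ℝ → ℝ → E3 := fun x y => !₂[x, y, f x * g y]

/-- The graph of `z = f(x) g(y)` over `I × J`, as a subset of Euclidean space. -/
def homotheticalSurface (I J : Set ℝ) (f g : ℝ → ℝ) : Set E3 :=
  {p | ∃ x ∈ I, ∃ y ∈ J, p = homotheticalParam f g x y}

/-- `S` is a cylindrical surface over a plane curve: it is swept out by segments (or half-lines,
or lines) parallel to a fixed direction `w`, `S = {α(t) + s w : t ∈ T, s ∈ R}` with `T`, `R` open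
intervals, where the base curve `α` is smooth, regular and lies in a plane to which `w` is not
parallel. -/
def IsCylindricalOverPlaneCurve (S : Set E3) : Prop :=
  ∃ (T R : Set ℝ) (α : ℝ → E3) (P : AffineSubspace ℝ E3) (w : E3),
    IsOpen T ∧ T.OrdConnected ∧ T.Nonempty ∧
    IsOpen R ∧ R.OrdConnected ∧ R.Nonempty ∧
    ContDiffOn ℝ ∞ α T ∧ (∀ t ∈ T, deriv α t ≠ 0) ∧
    Module.finrank ℝ P.direction = 2 ∧ (∀ t ∈ T, α t ∈ P) ∧ w ∉ P.direction ∧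
    S = {p | ∃ t ∈ T, ∃ s ∈ R, p = α t + s • w}

/-- The real power `u ^ r` makes sense (and is smooth in `u`): the base is positive, or the exponent
is an integer, and then the base is nonzero unless the exponent is positive. In these cases
`u ^ r` in Lean is the usual power. -/
def PowMeaningful (u r : ℝ) : Prop :=
  0 < u ∨ ∃ n : ℤ, r = n ∧ (u ≠ 0 ∨ 0 < n)

end

/-!
With `u = f²`, `p = f'²`, `v = g²`, `q = g'²`, the surface `z = f(x) g(y)` has Gauss curvature `K`
exactly when `f f'' · g g'' - p q = K (1 + p v + u q)²` (`curvature_equation`).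

*Why `K = 0`.* Expand the square: the equation says that the vector
`(f f'', 1, u, u², p, p u, p²)` is orthogonal in `ℝ⁷` to a vector depending only on `y`, whose
entries for `K ≠ 0` are, up to an invertible linear map, the same expressions in `g`. The
dimensions of the two spans add up to at most `7`, so by symmetry the span of the first may be
taken to be at most `3`. If `f f'` is not identically zero, `u` takes infinitely many values, so
`1, u, u²` are independent, and both `p` and `p u` are quadratic polynomials in `u`; hence
`p = β u + γ` and `f'' = β f`. Comparing coefficients in `u` now gives `q = -β v` and
`K (1 + γ v)² = β γ v`, and the constant term in `v` is `K = 0` (`curvature_eq_zero`).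

*The flat surfaces.* If `f` or `g` is constant the surface is a cylinder. Otherwise
`f f'' · g g'' = f'² g'²` separates into `f f'' = μ f'²` and `g g'' = μ⁻¹ g'²` with `μ ≠ 0`. Where
`f` has no zeros, `f'` is a constant multiple of `f ^ μ` up to sign, so `f` is an exponential
(`μ = 1`) or `± (a x + b) ^ m` with `m = 1 / (1 - μ)`; the exponent of `g` is then `1 - m`.

Zeros of `f` need the smoothness. Next to a zero, `f` is a power `C |x - z| ^ m`, and bounded
derivatives of all orders force `m` to be a natural number (`exists_nat_of_zero`). Then `f` is a
polynomial of degree at most `m` near every point of a dense set (the set where `f ≠ 0` and the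
interior of its complement), so its derivative of order `m + 1` vanishes and a single formula holds
on the whole interval (`eq_zero_of_frequently_locally_polynomial`, `exists_eq_rpow`).
-/

/-! ### The curvature equation of a homothetical surface -/

theorem hasDerivAt_vec3 {a b c : ℝ → ℝ} {a' b' c' x : ℝ} (ha : HasDerivAt a a' x)
    (hb : HasDerivAt b b' x) (hc : HasDerivAt c c' x) :
    HasDerivAt (fun s => (!₂[a s, b s, c s] : E3)) !₂[a', b', c'] x := by
  have h : HasDerivAt (fun s => ![a s, b s, c s]) ![a', b', c'] x := by
    rw [hasDerivAt_pi]
    intro i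
    fin_cases i
    · exact ha
    · exact hb
    · exact hc
  exact (PiLp.hasFDerivAt_toLp (𝕜 := ℝ) 2 (![a x, b x, c x])).comp_hasDerivAt x h

theorem contDiffOn_deriv {I : Set ℝ} (hI : IsOpen I) {f : ℝ → ℝ} (hf : ContDiffOn ℝ ∞ f I) :
    ContDiffOn ℝ ∞ (deriv f) I :=
  hf.deriv_of_isOpen hI (by simp)

theorem hasDerivAt_of_contDiffOn {I : Set ℝ} (hI : IsOpen I) {f : ℝ → ℝ}
    (hf : ContDiffOn ℝ ∞ f I) {x : ℝ} (hx : x ∈ I) : HasDerivAt f (deriv f x) x :=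
  ((hf.differentiableOn (by simp)).differentiableAt (hI.mem_nhds hx)).hasDerivAt

section Curvature

open ParamSurface

variable {I J : Set ℝ} {f g : ℝ → ℝ}

theorem du_homotheticalParam (hI : IsOpen I) (hf : ContDiffOn ℝ ∞ f I) {x : ℝ} (hx : x ∈ I)
    (y : ℝ) : du (homotheticalParam f g) x y = !₂[1, 0, deriv f x * g y] :=
  (hasDerivAt_vec3 (hasDerivAt_id x) (hasDerivAt_const x y)
    ((hasDerivAt_of_contDiffOn hI hf hx).mul_const (g y))).deriv

theorem dv_homotheticalParam (hJ : IsOpen J) (hg : ContDiffOn ℝ ∞ g J) (x : ℝ) {y : ℝ}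
    (hy : y ∈ J) : dv (homotheticalParam f g) x y = !₂[0, 1, f x * deriv g y] :=
  (hasDerivAt_vec3 (hasDerivAt_const y x) (hasDerivAt_id y)
    ((hasDerivAt_of_contDiffOn hJ hg hy).const_mul (f x))).deriv

theorem du_du_homotheticalParam (hI : IsOpen I) (hf : ContDiffOn ℝ ∞ f I) {x : ℝ} (hx : x ∈ I)
    (y : ℝ) : du (du (homotheticalParam f g)) x y = !₂[0, 0, deriv (deriv f) x * g y] := by
  refine HasDerivAt.deriv (HasDerivAt.congr_of_eventuallyEq ?_
    (Filter.eventually_of_mem (hI.mem_nhds hx) fun s hs => du_homotheticalParam hI hf hs y))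
  exact hasDerivAt_vec3 (hasDerivAt_const x 1) (hasDerivAt_const x 0)
    ((hasDerivAt_of_contDiffOn hI (contDiffOn_deriv hI hf) hx).mul_const (g y))

theorem dv_du_homotheticalParam (hI : IsOpen I) (hf : ContDiffOn ℝ ∞ f I) (hJ : IsOpen J)
    (hg : ContDiffOn ℝ ∞ g J) {x y : ℝ} (hx : x ∈ I) (hy : y ∈ J) :
    dv (du (homotheticalParam f g)) x y = !₂[0, 0, deriv f x * deriv g y] := by
  refine HasDerivAt.deriv (HasDerivAt.congr_of_eventuallyEq ?_
    (Filter.Eventually.of_forall fun t => du_homotheticalParam hI hf hx t))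
  exact hasDerivAt_vec3 (hasDerivAt_const y 1) (hasDerivAt_const y 0)
    ((hasDerivAt_of_contDiffOn hJ hg hy).const_mul (deriv f x))

theorem dv_dv_homotheticalParam (hJ : IsOpen J) (hg : ContDiffOn ℝ ∞ g J) (x : ℝ) {y : ℝ}
    (hy : y ∈ J) : dv (dv (homotheticalParam f g)) x y = !₂[0, 0, f x * deriv (deriv g) y] := by
  refine HasDerivAt.deriv (HasDerivAt.congr_of_eventuallyEq ?_
    (Filter.eventually_of_mem (hJ.mem_nhds hy) fun t ht => dv_homotheticalParam hJ hg x ht))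
  exact hasDerivAt_vec3 (hasDerivAt_const y 0) (hasDerivAt_const y 1)
    ((hasDerivAt_of_contDiffOn hJ (contDiffOn_deriv hJ hg) hy).const_mul (f x))

/-- The Gauss curvature of the graph of `f(x) g(y)`, with denominators cleared. -/
theorem curvature_equation (hI : IsOpen I) (hf : ContDiffOn ℝ ∞ f I) (hJ : IsOpen J)
    (hg : ContDiffOn ℝ ∞ g J) {x y : ℝ} (hx : x ∈ I) (hy : y ∈ J) :
    f x * deriv (deriv f) x * (g y * deriv (deriv g) y) - deriv f x ^ 2 * deriv g y ^ 2 =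
      gaussCurvature (homotheticalParam f g) x y *
        (1 + deriv f x ^ 2 * g y ^ 2 + f x ^ 2 * deriv g y ^ 2) ^ 2 := by
  set W := 1 + deriv f x ^ 2 * g y ^ 2 + f x ^ 2 * deriv g y ^ 2 with hW
  have hWpos : 0 < W := by positivity
  have hN : normal (homotheticalParam f g) x y =
      !₂[-(deriv f x * g y), -(f x * deriv g y), 1] := by
    rw [normal, du_homotheticalParam hI hf hx, dv_homotheticalParam hJ hg x hy]
    ext i
    fin_cases i <;> simp [crossProduct]
  have hnorm : ‖normal (homotheticalParam f g) x y‖ ^ 2 = W := by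
    rw [hN, EuclideanSpace.norm_sq_eq, hW]
    simp [Fin.sum_univ_three]
    ring
  set ν := ‖normal (homotheticalParam f g) x y‖ with hν
  have hν0 : ν ≠ 0 := by
    intro h
    rw [h] at hnorm
    simp at hnorm
    exact hWpos.ne hnorm
  have hl : coeffl (homotheticalParam f g) x y = ν⁻¹ * (deriv (deriv f) x * g y) := by
    rw [coeffl, unitNormal, inner_smul_right, ← hν, du_du_homotheticalParam hI hf hx, hN]
    simp [PiLp.inner_apply, Fin.sum_univ_three]
  have hm : coeffm (homotheticalParam f g) x y = ν⁻¹ * (deriv f x * deriv g y) := by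
    rw [coeffm, unitNormal, inner_smul_right, ← hν, dv_du_homotheticalParam hI hf hJ hg hx hy, hN]
    simp [PiLp.inner_apply, Fin.sum_univ_three]
  have hn : coeffn (homotheticalParam f g) x y = ν⁻¹ * (f x * deriv (deriv g) y) := by
    rw [coeffn, unitNormal, inner_smul_right, ← hν, dv_dv_homotheticalParam hJ hg x hy, hN]
    simp [PiLp.inner_apply, Fin.sum_univ_three]
  have hE : coeffE (homotheticalParam f g) x y = 1 + (deriv f x * g y) ^ 2 := by
    rw [coeffE, du_homotheticalParam hI hf hx, real_inner_self_eq_norm_sq,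
      EuclideanSpace.norm_sq_eq]
    simp [Fin.sum_univ_three]
  have hF : coeffF (homotheticalParam f g) x y = (deriv f x * g y) * (f x * deriv g y) := by
    rw [coeffF, du_homotheticalParam hI hf hx, dv_homotheticalParam hJ hg x hy]
    simp [PiLp.inner_apply, Fin.sum_univ_three]
    ring
  have hG : coeffG (homotheticalParam f g) x y = 1 + (f x * deriv g y) ^ 2 := by
    rw [coeffG, dv_homotheticalParam hJ hg x hy, real_inner_self_eq_norm_sq,
      EuclideanSpace.norm_sq_eq]
    simp [Fin.sum_univ_three]
  have hden : (1 + (deriv f x * g y) ^ 2) * (1 + (f x * deriv g y) ^ 2) -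
      ((deriv f x * g y) * (f x * deriv g y)) ^ 2 = W := by
    rw [hW]; ring
  rw [gaussCurvature, hl, hm, hn, hE, hF, hG, hden, ← hnorm]
  field_simp

end Curvature

/-! ### Constant Gauss curvature is zero -/

theorem cubic_coeffs_eq_zero {U : Set ℝ} (hU : U.Infinite) {a b c d : ℝ}
    (h : ∀ u ∈ U, a * u ^ 3 + b * u ^ 2 + c * u + d = 0) : a = 0 ∧ b = 0 ∧ c = 0 ∧ d = 0 := by
  open Polynomial in
  have hP : (C a * X ^ 3 + C b * X ^ 2 + C c * X + C d : ℝ[X]) = 0 :=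
    eq_zero_of_infinite_isRoot _ (hU.mono fun u hu => by simpa using h u hu)
  refine ⟨?_, ?_, ?_, ?_⟩
  · simpa [Polynomial.coeff_X, Polynomial.coeff_C, Polynomial.coeff_X_pow] using
      congrArg (fun p => Polynomial.coeff p 3) hP
  · simpa [Polynomial.coeff_X, Polynomial.coeff_C, Polynomial.coeff_X_pow] using
      congrArg (fun p => Polynomial.coeff p 2) hP
  · simpa [Polynomial.coeff_X, Polynomial.coeff_C, Polynomial.coeff_X_pow] using
      congrArg (fun p => Polynomial.coeff p 1) hP
  · simpa [Polynomial.coeff_X, Polynomial.coeff_C, Polynomial.coeff_X_pow] using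
      congrArg (fun p => Polynomial.coeff p 0) hP

/-- Two mutually orthogonal families of vectors in `ℝ⁷` cannot both span a space of dimension at
least `4`. -/
theorem finrank_span_le_three_or_of_inner_eq_zero {s t : Set (EuclideanSpace ℝ (Fin 7))}
    (h : ∀ v ∈ s, ∀ w ∈ t, inner ℝ v w = 0) :
    Module.finrank ℝ (Submodule.span ℝ s) ≤ 3 ∨ Module.finrank ℝ (Submodule.span ℝ t) ≤ 3 := by
  have hle : Submodule.span ℝ s ≤ (Submodule.span ℝ t)ᗮ := Submodule.isOrtho_span.2 h
  have h1 := Submodule.finrank_mono hle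
  have h2 := (Submodule.span ℝ t).finrank_add_finrank_orthogonal
  rw [finrank_euclideanSpace_fin] at h2
  omega

/-- Any four linear functionals satisfy a nontrivial linear relation on a space of dimension at
most `3`. -/
theorem exists_linear_relation {E : Type*} [AddCommGroup E] [Module ℝ E] [FiniteDimensional ℝ E]
    {s : Set E} (hs : Module.finrank ℝ (Submodule.span ℝ s) ≤ 3) (L : E →ₗ[ℝ] (Fin 4 → ℝ)) :
    ∃ c : Fin 4 → ℝ, c ≠ 0 ∧
      ∀ v ∈ s, L v 0 * c 0 + L v 1 * c 1 + L v 2 * c 2 + L v 3 * c 3 = 0 := by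
  have hlt : (Submodule.span ℝ s).map L < ⊤ := by
    rw [lt_top_iff_ne_top]
    intro htop
    have h1 := Submodule.finrank_map_le L (Submodule.span ℝ s)
    rw [htop, finrank_top, Module.finrank_fin_fun] at h1
    omega
  obtain ⟨φ, hφ, hle⟩ := Submodule.exists_le_ker_of_lt_top _ hlt
  refine ⟨fun i => φ (Pi.single i 1), fun hc => hφ ?_, fun v hv => ?_⟩
  · refine LinearMap.pi_ext' fun i => LinearMap.ext_ring ?_
    simpa using congrFun hc i
  · have h0 : φ (L v) = 0 := hle (Submodule.mem_map_of_mem (Submodule.subset_span hv))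
    rw [LinearMap.pi_apply_eq_sum_univ] at h0
    have hsingle : ∀ i : Fin 4, (fun j => if i = j then (1 : ℝ) else 0) = Pi.single i 1 :=
      fun i => funext fun j => by simp [Pi.single_apply, eq_comm]
    simpa only [smul_eq_mul, Fin.sum_univ_four, hsingle] using h0

/-- If the vectors `(1, u, u², p, p u)` take values in a space of dimension at most `3`, and `u`
takes infinitely many values, then `p` is an affine function of `u`. -/
theorem exists_affine_relation {S E : Type*} [AddCommGroup E] [Module ℝ E]
    [FiniteDimensional ℝ E] (X : S → E)
    (hX : Module.finrank ℝ (Submodule.span ℝ (Set.range X)) ≤ 3) {u p : S → ℝ}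
    (hu : (Set.range u).Infinite) (L₁ L₂ : E →ₗ[ℝ] (Fin 4 → ℝ))
    (h₁ : ∀ s, L₁ (X s) = ![1, u s, u s ^ 2, p s])
    (h₂ : ∀ s, L₂ (X s) = ![1, u s, u s ^ 2, p s * u s]) :
    ∃ β γ : ℝ, ∀ s, p s = β * u s + γ := by
  -- a relation between `1, u, u²` and a fourth function `q` can be solved for `q`
  have key : ∀ (q : S → ℝ) (L : E →ₗ[ℝ] (Fin 4 → ℝ)),
      (∀ s, L (X s) = ![1, u s, u s ^ 2, q s]) →
      ∃ a b c : ℝ, ∀ s, q s = a * u s ^ 2 + b * u s + c := by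
    intro q L hL
    obtain ⟨c, hc, hrel⟩ := exists_linear_relation hX L
    have hrel' : ∀ s, c 0 + u s * c 1 + u s ^ 2 * c 2 + q s * c 3 = 0 := by
      intro s
      have := hrel (X s) ⟨s, rfl⟩
      rw [hL s] at this
      simpa using this
    have h3 : c 3 ≠ 0 := by
      intro h3
      obtain ⟨-, h2, h1, h0⟩ := cubic_coeffs_eq_zero hu (a := 0) (b := c 2) (c := c 1) (d := c 0)
        (by
          rintro _ ⟨s, rfl⟩
          have := hrel' s
          rw [h3] at this
          linarith)
      apply hc
      ext i
      fin_cases i <;> simp [h0, h1, h2, h3]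
    refine ⟨-c 2 / c 3, -c 1 / c 3, -c 0 / c 3, fun s => ?_⟩
    field_simp
    linarith [hrel' s]
  obtain ⟨a, b, c, h⟩ := key p L₁ h₁
  obtain ⟨a', b', c', h'⟩ := key (fun s => p s * u s) L₂ h₂
  obtain ⟨ha, -⟩ := cubic_coeffs_eq_zero hu (a := a) (b := b - a') (c := c - b') (d := -c')
    (by
      rintro _ ⟨s, rfl⟩
      have := h' s
      simp only [h s] at this
      linarith)
  exact ⟨b, c, fun s => by rw [h s, ha]; ring⟩

/-- If `f'²` is an affine function of `f²`, the curvature equation with `K ≠ 0` is impossible,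
by comparison of coefficients in `u = f²` and then in `v = g²`. Here `p = f'²`, `q = g'²`,
`f f'' = β u` and `G = g g''`. -/
theorem eq_zero_of_affine_relation {U : Set ℝ} (hU : U.Infinite) {T : Type*} {v q G : T → ℝ}
    (hv : (Set.range v).Infinite) {β γ K : ℝ}
    (h : ∀ u ∈ U, ∀ t, β * u * G t - (β * u + γ) * q t =
      K * (1 + (β * u + γ) * v t + u * q t) ^ 2) : K = 0 := by
  by_contra hK
  have hcoef : ∀ t, q t = -β * v t ∧ K * (1 + γ * v t) ^ 2 + γ * q t = 0 := by
    intro t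
    obtain ⟨-, h2, -, h0⟩ := cubic_coeffs_eq_zero hU (a := 0) (b := K * (β * v t + q t) ^ 2)
      (c := 2 * K * (1 + γ * v t) * (β * v t + q t) + β * q t - β * G t)
      (d := K * (1 + γ * v t) ^ 2 + γ * q t)
      (fun u hu => by linear_combination - h u hu t)
    have h3 : β * v t + q t = 0 := by simpa [hK] using h2
    exact ⟨by linarith, h0⟩
  obtain ⟨-, -, -, hd⟩ := cubic_coeffs_eq_zero hv (a := 0) (b := K * γ ^ 2)
    (c := 2 * K * γ - γ * β) (d := K)
    (by
      rintro _ ⟨t, rfl⟩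
      obtain ⟨h1, h2⟩ := hcoef t
      rw [h1] at h2
      linear_combination h2)
  exact hK hd

/-- Near a point where `f f' ≠ 0`, the function `f²` takes infinitely many values. -/
theorem exists_subset_infinite_sq {I : Set ℝ} (hI : IsOpen I) {f : ℝ → ℝ}
    (hf : ContDiffOn ℝ ∞ f I) {x₁ : ℝ} (hx₁ : x₁ ∈ I) (h : f x₁ * deriv f x₁ ≠ 0) :
    ∃ I' ⊆ I, IsOpen I' ∧ (∀ x ∈ I', f x * deriv f x ≠ 0) ∧
      (Set.range fun x : I' => f x ^ 2).Infinite := by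
  have hcont : ContinuousOn (fun x => f x * deriv f x) I :=
    hf.continuousOn.mul (contDiffOn_deriv hI hf).continuousOn
  have hev : ∀ᶠ x in nhds x₁, x ∈ I ∧ f x * deriv f x ≠ 0 :=
    Filter.Eventually.and (hI.mem_nhds hx₁) ((hcont.continuousAt (hI.mem_nhds hx₁)).eventually_ne h)
  obtain ⟨r, hr, hball⟩ := Metric.eventually_nhds_iff_ball.1 hev
  refine ⟨Metric.ball x₁ r, fun x hx => (hball x hx).1, Metric.isOpen_ball, fun x hx => (hball x hx).2, ?_⟩
  rw [← Set.image_eq_range (fun x => f x ^ 2)]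
  have hconn : IsPreconnected ((fun x => f x ^ 2) '' Metric.ball x₁ r) :=
    (convex_ball x₁ r).isPreconnected.image _
      ((hf.continuousOn.mono fun x hx => (hball x hx).1).pow 2)
  refine hconn.infinite_of_nontrivial ?_
  by_contra hsub
  rw [Set.not_nontrivial_iff] at hsub
  have hx₁r : x₁ ∈ Metric.ball x₁ r := Metric.mem_ball_self hr
  have hconst : (fun x => f x ^ 2) =ᶠ[nhds x₁] fun _ => f x₁ ^ 2 :=
    Filter.eventually_of_mem (Metric.ball_mem_nhds x₁ hr) fun x hx =>
      hsub ⟨x, hx, rfl⟩ ⟨x₁, hx₁r, rfl⟩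
  have h1 : HasDerivAt (fun x => f x ^ 2) (2 * (f x₁ * deriv f x₁)) x₁ := by
    have := (hasDerivAt_of_contDiffOn hI hf hx₁).pow 2
    convert! this using 1
    push_cast
    ring
  have h2 := h1.unique (HasDerivAt.congr_of_eventuallyEq (hasDerivAt_const x₁ _) hconst)
  exact h (by linarith)

/-- If `f'²` is an affine function of `f²` near a point where `f f' ≠ 0`, then `K = 0`. -/
theorem curvature_eq_zero_of_affine {I : Set ℝ} {f : ℝ → ℝ} {I' : Set ℝ} (hI : IsOpen I)
    (hf : ContDiffOn ℝ ∞ f I) (hI'I : I' ⊆ I)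
    (hI'open : IsOpen I') (hne : ∀ x ∈ I', f x * deriv f x ≠ 0)
    (hinf : (Set.range fun x : I' => f x ^ 2).Infinite)
    {g : ℝ → ℝ} {J' : Set ℝ} (hinf' : (Set.range fun y : J' => g y ^ 2).Infinite)
    {K β γ : ℝ}
    (heq : ∀ x ∈ I', ∀ y ∈ J', f x * deriv (deriv f) x * (g y * deriv (deriv g) y) -
      deriv f x ^ 2 * deriv g y ^ 2 =
        K * (1 + deriv f x ^ 2 * g y ^ 2 + f x ^ 2 * deriv g y ^ 2) ^ 2)
    (haff : ∀ x : I', deriv f x ^ 2 = β * f x ^ 2 + γ) : K = 0 := by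
  -- differentiate the affine relation and divide by `f'`
  have hsecond : ∀ x ∈ I', deriv (deriv f) x = β * f x := by
    intro x hx
    have hd := hasDerivAt_of_contDiffOn hI hf (hI'I hx)
    have hd' := hasDerivAt_of_contDiffOn hI (contDiffOn_deriv hI hf) (hI'I hx)
    have h1 := (((hd.fun_pow 2).const_mul β).add_const γ).congr_of_eventuallyEq
      (f₁ := fun s => deriv f s ^ 2) (Filter.eventually_of_mem (hI'open.mem_nhds hx) fun s hs => haff ⟨s, hs⟩)
    have h2 := h1.unique (hd'.fun_pow 2)
    refine mul_left_cancel₀ (right_ne_zero_of_mul (hne x hx)) ?_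
    simp only [Nat.cast_ofNat, Nat.add_one_sub_one, pow_one] at h2
    linarith
  refine eq_zero_of_affine_relation hinf (T := J') (v := fun y => g y ^ 2)
    (q := fun y => deriv g y ^ 2) (G := fun y => g y * deriv (deriv g) y) hinf' (β := β)
    (γ := γ) ?_
  rintro _ ⟨x, rfl⟩ y
  have h := heq x x.2 y y.2
  rw [hsecond x x.2, haff x] at h
  simp only
  linear_combination h

/-- If the curvature equation holds and `f f'` vanishes identically, then `K = 0`. -/
theorem curvature_eq_zero_of_mul_deriv_eq_zero {I J : Set ℝ} (hI : IsOpen I) {f g : ℝ → ℝ}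
    (hf : ContDiffOn ℝ ∞ f I) {K x₀ y₀ : ℝ} (hx₀ : x₀ ∈ I) (hy₀ : y₀ ∈ J)
    (heq : ∀ x ∈ I, ∀ y ∈ J, f x * deriv (deriv f) x * (g y * deriv (deriv g) y) -
      deriv f x ^ 2 * deriv g y ^ 2 =
        K * (1 + deriv f x ^ 2 * g y ^ 2 + f x ^ 2 * deriv g y ^ 2) ^ 2)
    (hzero : ∀ x ∈ I, f x * deriv f x = 0) : K = 0 := by
  have hd := hasDerivAt_of_contDiffOn hI hf hx₀
  have hd' := hasDerivAt_of_contDiffOn hI (contDiffOn_deriv hI hf) hx₀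
  have h1 := (hd.mul hd').unique (HasDerivAt.congr_of_eventuallyEq (hasDerivAt_const x₀ (0 : ℝ))
    (Filter.eventually_of_mem (hI.mem_nhds hx₀) hzero))
  have hp : deriv f x₀ = 0 := by
    rcases mul_eq_zero.1 (hzero x₀ hx₀) with h0 | h0
    · rw [h0] at h1
      simpa using h1
    · exact h0
  have hff : f x₀ * deriv (deriv f) x₀ = 0 := by
    rw [hp] at h1
    simpa using h1
  have h := heq x₀ hx₀ y₀ hy₀
  rw [hff, hp] at h
  have hW : (0 : ℝ) < (1 + 0 ^ 2 * g y₀ ^ 2 + f x₀ ^ 2 * deriv g y₀ ^ 2) ^ 2 := by positivity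
  have h2 : K * (1 + 0 ^ 2 * g y₀ ^ 2 + f x₀ ^ 2 * deriv g y₀ ^ 2) ^ 2 = 0 := by
    rw [← h]; ring
  exact (mul_eq_zero.1 h2).resolve_right hW.ne'

/-- A homothetical surface of constant Gauss curvature `K` has `K = 0`. Sorted by monomials, the
curvature equation says that a vector in `ℝ⁷` depending on `x` is orthogonal to one depending on
`y`; so one of the two families spans at most three dimensions, and `f'²` is an affine function of
`f²`, or `g'²` of `g²`. -/
theorem curvature_eq_zero {I J : Set ℝ} (hI : IsOpen I) (hIn : I.Nonempty) (hJ : IsOpen J)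
    (hJn : J.Nonempty) {f g : ℝ → ℝ} (hf : ContDiffOn ℝ ∞ f I) (hg : ContDiffOn ℝ ∞ g J) {K : ℝ}
    (heq : ∀ x ∈ I, ∀ y ∈ J, f x * deriv (deriv f) x * (g y * deriv (deriv g) y) -
      deriv f x ^ 2 * deriv g y ^ 2 =
        K * (1 + deriv f x ^ 2 * g y ^ 2 + f x ^ 2 * deriv g y ^ 2) ^ 2) : K = 0 := by
  have hsymm : ∀ y ∈ J, ∀ x ∈ I, g y * deriv (deriv g) y * (f x * deriv (deriv f) x) -
      deriv g y ^ 2 * deriv f x ^ 2 =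
        K * (1 + deriv g y ^ 2 * f x ^ 2 + g y ^ 2 * deriv f x ^ 2) ^ 2 := by
    intro y hy x hx
    linear_combination heq x hx y hy
  by_cases hfz : ∀ x ∈ I, f x * deriv f x = 0
  · exact curvature_eq_zero_of_mul_deriv_eq_zero hI hf hIn.some_mem hJn.some_mem heq hfz
  by_cases hgz : ∀ y ∈ J, g y * deriv g y = 0
  · exact curvature_eq_zero_of_mul_deriv_eq_zero hJ hg hJn.some_mem hIn.some_mem hsymm hgz
  push Not at hfz hgz
  obtain ⟨x₁, hx₁, hfx₁⟩ := hfz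
  obtain ⟨y₁, hy₁, hgy₁⟩ := hgz
  obtain ⟨I', hI'I, hI'o, hI'ne, hI'inf⟩ := exists_subset_infinite_sq hI hf hx₁ hfx₁
  obtain ⟨J', hJ'J, hJ'o, hJ'ne, hJ'inf⟩ := exists_subset_infinite_sq hJ hg hy₁ hgy₁
  by_contra hK
  let X : I' → EuclideanSpace ℝ (Fin 7) := fun x =>
    !₂[f x * deriv (deriv f) x, 1, f x ^ 2, (f x ^ 2) ^ 2, deriv f x ^ 2,
      deriv f x ^ 2 * f x ^ 2, (deriv f x ^ 2) ^ 2]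
  let Y : J' → EuclideanSpace ℝ (Fin 7) := fun y =>
    !₂[g y * deriv (deriv g) y, -K, -(2 * K * deriv g y ^ 2), -(K * (deriv g y ^ 2) ^ 2),
      -(deriv g y ^ 2 + 2 * K * g y ^ 2), -(2 * K * g y ^ 2 * deriv g y ^ 2),
      -(K * (g y ^ 2) ^ 2)]
  have hXY : ∀ v ∈ Set.range X, ∀ w ∈ Set.range Y, inner ℝ v w = 0 := by
    rintro _ ⟨x, rfl⟩ _ ⟨y, rfl⟩
    have := heq x (hI'I x.2) y (hJ'J y.2)
    simp only [X, Y, PiLp.inner_apply, Fin.sum_univ_seven]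
    simp
    linear_combination this
  -- coordinate changes that extract `1, u, u², p` and `1, u, u², p u` from either vector
  let A : (Fin 4 → Fin 7 → ℝ) → EuclideanSpace ℝ (Fin 7) →ₗ[ℝ] (Fin 4 → ℝ) := fun M =>
    (Matrix.mulVecLin (Matrix.of M)) ∘ₗ (WithLp.linearEquiv 2 ℝ (Fin 7 → ℝ)).toLinearMap
  rcases finrank_span_le_three_or_of_inner_eq_zero hXY with h | h
  · obtain ⟨β, γ, hβγ⟩ := exists_affine_relation X h (u := fun x : I' => f x ^ 2)
      (p := fun x : I' => deriv f x ^ 2) hI'inf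
      (A ![![0, 1, 0, 0, 0, 0, 0], ![0, 0, 1, 0, 0, 0, 0], ![0, 0, 0, 1, 0, 0, 0],
        ![0, 0, 0, 0, 1, 0, 0]])
      (A ![![0, 1, 0, 0, 0, 0, 0], ![0, 0, 1, 0, 0, 0, 0], ![0, 0, 0, 1, 0, 0, 0],
        ![0, 0, 0, 0, 0, 1, 0]])
      (fun x => by
        ext i
        fin_cases i <;> simp [A, X, Matrix.mulVec, dotProduct, Fin.sum_univ_seven])
      (fun x => by
        ext i
        fin_cases i <;> simp [A, X, Matrix.mulVec, dotProduct, Fin.sum_univ_seven])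
    exact hK (curvature_eq_zero_of_affine hI hf hI'I hI'o hI'ne hI'inf hJ'inf
      (fun x hx y hy => heq x (hI'I hx) y (hJ'J hy)) hβγ)
  · obtain ⟨β, γ, hβγ⟩ := exists_affine_relation Y h (u := fun y : J' => g y ^ 2)
      (p := fun y : J' => deriv g y ^ 2) hJ'inf
      (A ![![0, -K⁻¹, 0, 0, 0, 0, 0], ![0, 0, (2 * K)⁻¹ * (2 * K)⁻¹, 0, -(2 * K)⁻¹, 0, 0],
        ![0, 0, 0, 0, 0, 0, -K⁻¹], ![0, 0, -(2 * K)⁻¹, 0, 0, 0, 0]])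
      (A ![![0, -K⁻¹, 0, 0, 0, 0, 0], ![0, 0, (2 * K)⁻¹ * (2 * K)⁻¹, 0, -(2 * K)⁻¹, 0, 0],
        ![0, 0, 0, 0, 0, 0, -K⁻¹], ![0, 0, 0, 0, 0, -(2 * K)⁻¹, 0]])
      (fun y => by
        ext i
        fin_cases i <;> simp [A, Y, Matrix.mulVec, dotProduct, Fin.sum_univ_seven, hK]
        · field_simp
          ring
        · field_simp)
      (fun y => by
        ext i
        fin_cases i <;> simp [A, Y, Matrix.mulVec, dotProduct, Fin.sum_univ_seven, hK]
        · field_simp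
          ring
        · field_simp)
    exact hK (curvature_eq_zero_of_affine hJ hg hJ'J hJ'o hJ'ne hJ'inf hI'inf
      (fun y hy x hx => hsymm y (hJ'J hy) x (hI'I hx)) hβγ)

/-! ### The equation `f f'' = μ f'²` -/

/-- On an interval on which `f > 0`, the equation `f f'' = μ f'²` has the first integral
`f' f ^ (-μ)`. -/
theorem exists_deriv_eq_mul_rpow {I : Set ℝ} (hI : IsOpen I) (hIp : IsPreconnected I)
    {f : ℝ → ℝ} (hf : ContDiffOn ℝ ∞ f I) {μ : ℝ}
    (hode : ∀ x ∈ I, f x * deriv (deriv f) x = μ * deriv f x ^ 2) (hpos : ∀ x ∈ I, 0 < f x) :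
    ∃ k, ∀ x ∈ I, deriv f x = k * f x ^ μ := by
  have hder : ∀ x ∈ I, HasDerivAt (fun s => deriv f s * f s ^ (-μ)) 0 x := by
    intro x hx
    have hd := hasDerivAt_of_contDiffOn hI hf hx
    have hd' := hasDerivAt_of_contDiffOn hI (contDiffOn_deriv hI hf) hx
    have h := hd'.fun_mul (hd.rpow_const (p := -μ) (Or.inl (hpos x hx).ne'))
    convert! h using 1
    rw [Real.rpow_sub_one (hpos x hx).ne']
    have := (hpos x hx).ne'
    field_simp
    linear_combination - f x ^ (-μ) * hode x hx
  obtain ⟨k, hk⟩ := hI.exists_is_const_of_deriv_eq_zero hIp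
    (fun x hx => (hder x hx).differentiableAt.differentiableWithinAt) (fun x hx => (hder x hx).deriv)
  refine ⟨k, fun x hx => ?_⟩
  rw [← hk x hx, mul_assoc, ← Real.rpow_add (hpos x hx)]
  simp

/-- Functions without zeros on an interval have a constant sign. -/
theorem exists_sign_of_ne_zero {I : Set ℝ} (hIp : IsPreconnected I) {f : ℝ → ℝ}
    (hf : ContinuousOn f I) (hne : ∀ x ∈ I, f x ≠ 0) :
    ∃ ε : ℝ, (ε = 1 ∨ ε = -1) ∧ ∀ x ∈ I, 0 < ε * f x := by
  by_cases h : ∀ x ∈ I, 0 < f x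
  · exact ⟨1, Or.inl rfl, fun x hx => by simpa using h x hx⟩
  · push Not at h
    obtain ⟨a, ha, hfa⟩ := h
    refine ⟨-1, Or.inr rfl, fun x hx => ?_⟩
    by_contra hx0
    have hx0 : 0 ≤ f x := by linarith
    obtain ⟨z, hz, hfz⟩ := hIp.intermediate_value ha hx hf ⟨hfa, hx0⟩
    exact hne z hz hfz

theorem ode_const_mul {I : Set ℝ} {f : ℝ → ℝ} {μ : ℝ}
    (hode : ∀ x ∈ I, f x * deriv (deriv f) x = μ * deriv f x ^ 2) (ε : ℝ) :
    ∀ x ∈ I, (fun s => ε * f s) x * deriv (deriv fun s => ε * f s) x =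
      μ * deriv (fun s => ε * f s) x ^ 2 := by
  intro x hx
  have h1 : deriv (fun s => ε * f s) = fun s => ε * deriv f s :=
    funext fun s => deriv_const_mul_field ε
  have h2 : deriv (fun s => ε * deriv f s) x = ε * deriv (deriv f) x := deriv_const_mul_field ε
  rw [h1, h2]
  linear_combination ε ^ 2 * hode x hx

/-- Solutions of `f f'' = f'²` without zeros are exponentials. -/
theorem exists_eq_exp_of_ne_zero {I : Set ℝ} (hI : IsOpen I) (hIp : IsPreconnected I)
    (hIn : I.Nonempty) {f : ℝ → ℝ} (hf : ContDiffOn ℝ ∞ f I)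
    (hode : ∀ x ∈ I, f x * deriv (deriv f) x = 1 * deriv f x ^ 2) (hne : ∀ x ∈ I, f x ≠ 0) :
    ∃ C k : ℝ, C ≠ 0 ∧ ∀ x ∈ I, f x = C * Real.exp (k * x) := by
  obtain ⟨ε, hε, hpos⟩ := exists_sign_of_ne_zero hIp hf.continuousOn hne
  obtain ⟨k, hk⟩ := exists_deriv_eq_mul_rpow hI hIp (contDiffOn_const.mul hf)
    (ode_const_mul hode ε) hpos
  have hε0 : ε ≠ 0 := by rcases hε with h | h <;> simp [h]
  have hder : ∀ x ∈ I, HasDerivAt (fun s => f s * Real.exp (-(k * s))) 0 x := by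
    intro x hx
    have hd := hasDerivAt_of_contDiffOn hI hf hx
    have h := hd.fun_mul ((hasDerivAt_id x).const_mul k).fun_neg.exp
    have hkx := hk x hx
    rw [deriv_const_mul_field, Real.rpow_one] at hkx
    have hkx' : deriv f x = k * f x := mul_left_cancel₀ hε0 (by linarith)
    convert! h using 1
    rw [hkx']
    simp
    ring
  obtain ⟨C, hC⟩ := hI.exists_is_const_of_deriv_eq_zero hIp
    (fun x hx => (hder x hx).differentiableAt.differentiableWithinAt) (fun x hx => (hder x hx).deriv)
  have hf' : ∀ x ∈ I, f x = C * Real.exp (k * x) := by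
    intro x hx
    rw [← hC x hx, mul_assoc, ← Real.exp_add]
    simp
  refine ⟨C, k, ?_, hf'⟩
  rintro rfl
  obtain ⟨x, hx⟩ := hIn
  exact hne x hx (by simp [hf' x hx])

/-- Solutions of `f f'' = μ f'²`, `μ ≠ 1`, without zeros are powers of affine functions. -/
theorem exists_eq_rpow_of_ne_zero {I : Set ℝ} (hI : IsOpen I) (hIp : IsPreconnected I)
    {f : ℝ → ℝ} (hf : ContDiffOn ℝ ∞ f I) {μ : ℝ} (hμ : μ ≠ 1)
    (hode : ∀ x ∈ I, f x * deriv (deriv f) x = μ * deriv f x ^ 2) (hne : ∀ x ∈ I, f x ≠ 0) :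
    ∃ ε a b : ℝ, (ε = 1 ∨ ε = -1) ∧
      ∀ x ∈ I, 0 < a * x + b ∧ f x = ε * (a * x + b) ^ (1 / (1 - μ)) := by
  obtain ⟨ε, hε, hpos⟩ := exists_sign_of_ne_zero hIp hf.continuousOn hne
  have hε2 : ε * ε = 1 := by rcases hε with h | h <;> simp [h]
  have hμ' : 1 - μ ≠ 0 := sub_ne_zero.2 hμ.symm
  obtain ⟨k, hk⟩ := exists_deriv_eq_mul_rpow hI hIp (contDiffOn_const.mul hf)
    (ode_const_mul hode ε) hpos
  have hder : ∀ x ∈ I, HasDerivAt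
      (fun s => (ε * f s) ^ (1 - μ) - (1 - μ) * k * s) 0 x := by
    intro x hx
    have hd := (hasDerivAt_of_contDiffOn hI hf hx).const_mul ε
    have h := (hd.rpow_const (p := 1 - μ) (Or.inl (hpos x hx).ne')).fun_sub
      ((hasDerivAt_id x).const_mul ((1 - μ) * k))
    have hkx := hk x hx
    rw [deriv_const_mul_field] at hkx
    convert! h using 1
    rw [hkx, show (1 : ℝ) - μ - 1 = -μ by ring, Real.rpow_neg (hpos x hx).le]
    have := (Real.rpow_pos_of_pos (hpos x hx) μ).ne'
    field_simp
    ring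
  obtain ⟨b, hb⟩ := hI.exists_is_const_of_deriv_eq_zero hIp
    (fun x hx => (hder x hx).differentiableAt.differentiableWithinAt) (fun x hx => (hder x hx).deriv)
  refine ⟨ε, (1 - μ) * k, b, hε, fun x hx => ?_⟩
  have h : (1 - μ) * k * x + b = (ε * f x) ^ (1 - μ) := by rw [← hb x hx]; ring
  rw [h, ← Real.rpow_mul (hpos x hx).le, mul_one_div_cancel hμ', Real.rpow_one, ← mul_assoc, hε2,
    one_mul]
  exact ⟨Real.rpow_pos_of_pos (hpos x hx) _, rfl⟩

/-! ### Zeros of solutions -/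

/-- If a function smooth at `z` agrees with `C (x - z) ^ m` to the right of `z`, then `m` is a
natural number: otherwise some derivative is a multiple of a negative power and blows up. -/
theorem exists_nat_of_eq_rpow {I : Set ℝ} (hI : IsOpen I) {z x₁ : ℝ} (hz : z ∈ I) (hzx : z < x₁)
    (k : ℕ) : ∀ {m C : ℝ} {f : ℝ → ℝ}, m < k → C ≠ 0 →
      ContDiffOn ℝ ∞ f I → (∀ x ∈ Set.Ioo z x₁, f x = C * (x - z) ^ m) → ∃ n : ℕ, m = n := by
  induction k with
  | zero =>
    intro m C f hm hC hf hfx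
    exfalso
    have hm : m < 0 := by simpa using hm
    have h1 : Filter.Tendsto f (nhdsWithin z (Set.Ioi z)) (nhds (f z)) :=
      (hf.continuousOn.continuousAt (hI.mem_nhds hz)).tendsto.mono_left nhdsWithin_le_nhds
    have hsubt : Filter.Tendsto (fun x => x - z) (nhdsWithin z (Set.Ioi z))
        (nhdsWithin 0 (Set.Ioi 0)) := by
      refine tendsto_nhdsWithin_iff.2 ⟨?_, ?_⟩
      · have : Filter.Tendsto (fun x => x - z) (nhds z) (nhds (z - z)) :=
          (continuous_id.sub continuous_const).tendsto z
        rw [sub_self] at this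
        exact this.mono_left nhdsWithin_le_nhds
      · filter_upwards [self_mem_nhdsWithin] with x hx
        exact sub_pos.2 (Set.mem_Ioi.1 hx)
    have h2 := (tendsto_rpow_neg_nhdsGT_zero hm).comp hsubt
    refine not_tendsto_nhds_of_tendsto_atTop h2 (C⁻¹ * f z) ((h1.const_mul C⁻¹).congr' ?_)
    filter_upwards [Ioo_mem_nhdsGT hzx] with x hx
    simp [hfx x hx, hC]
  | succ k ih =>
    intro m C f hm hC hf hfx
    by_cases hm0 : m = 0
    · exact ⟨0, by simpa using hm0⟩
    have hder : ∀ x ∈ Set.Ioo z x₁, deriv f x = C * m * (x - z) ^ (m - 1) := by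
      intro x hx
      have h := ((((hasDerivAt_id x).sub_const z).rpow_const (p := m)
        (Or.inl (sub_pos.2 hx.1).ne')).const_mul C).congr_of_eventuallyEq
          (Filter.eventually_of_mem (isOpen_Ioo.mem_nhds hx) hfx)
      rw [h.deriv]
      simp
      ring
    obtain ⟨n, hn⟩ := ih (m := m - 1) (by push_cast at hm; linarith) (mul_ne_zero hC hm0)
      (contDiffOn_deriv hI hf) hder
    exact ⟨n + 1, by push_cast; linarith⟩

/-- The case of `exists_nat_of_zero` in which `f` has no zeros on an interval starting at its zero
`z`. On that interval `f` is an exponential or a power of an affine function; as `f` tends to `0`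
at `z`, it is a power, and its base vanishes at `z`. -/
theorem exists_nat_of_zero_of_Ioo {I : Set ℝ} (hI : IsOpen I) {f : ℝ → ℝ}
    (hf : ContDiffOn ℝ ∞ f I) {μ : ℝ}
    (hode : ∀ x ∈ I, f x * deriv (deriv f) x = μ * deriv f x ^ 2) {z x₁ : ℝ} (hz : z ∈ I)
    (hzx : z < x₁) (hsub : Set.Ioo z x₁ ⊆ I) (hfz : f z = 0)
    (hne : ∀ x ∈ Set.Ioo z x₁, f x ≠ 0) : μ ≠ 1 ∧ ∃ n : ℕ, 1 / (1 - μ) = n := by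
  have hlim : Filter.Tendsto f (nhdsWithin z (Set.Ioi z)) (nhds 0) := by
    rw [← hfz]
    exact (hf.continuousOn.continuousAt (hI.mem_nhds hz)).tendsto.mono_left nhdsWithin_le_nhds
  -- a function agreeing with `f` to the right of `z` and continuous at `z` vanishes at `z`
  have hzero : ∀ F : ℝ → ℝ, ContinuousAt F z → (∀ x ∈ Set.Ioo z x₁, f x = F x) → F z = 0 := by
    intro F hF hfF
    refine tendsto_nhds_unique ((hF.tendsto.mono_left nhdsWithin_le_nhds).congr' ?_) hlim
    filter_upwards [Ioo_mem_nhdsGT hzx] with x hx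
    exact (hfF x hx).symm
  have hode' : ∀ x ∈ Set.Ioo z x₁, f x * deriv (deriv f) x = μ * deriv f x ^ 2 :=
    fun x hx => hode x (hsub hx)
  have hμ : μ ≠ 1 := by
    rintro rfl
    obtain ⟨C, k, hC, hfC⟩ := exists_eq_exp_of_ne_zero isOpen_Ioo isPreconnected_Ioo
      (Set.nonempty_Ioo.2 hzx) (hf.mono hsub) hode' hne
    have := hzero _ (by fun_prop) hfC
    simp [hC] at this
  refine ⟨hμ, ?_⟩
  obtain ⟨ε, a, b, hε, hab⟩ := exists_eq_rpow_of_ne_zero isOpen_Ioo isPreconnected_Ioo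
    (hf.mono hsub) hμ hode' hne
  have hε0 : ε ≠ 0 := by rcases hε with h | h <;> simp [h]
  have hcont : ContinuousAt (fun x => a * x + b) z := by fun_prop
  have hnonneg : 0 ≤ a * z + b := by
    refine ge_of_tendsto (hcont.tendsto.mono_left nhdsWithin_le_nhds :
      Filter.Tendsto _ (nhdsWithin z (Set.Ioi z)) _) ?_
    filter_upwards [Ioo_mem_nhdsGT hzx] with x hx
    exact (hab x hx).1.le
  have hbase : a * z + b = 0 := by
    by_contra hbase
    have h := hzero (fun x => ε * (a * x + b) ^ (1 / (1 - μ)))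
      (continuousAt_const.mul (hcont.rpow_const (Or.inl hbase))) (fun x hx => (hab x hx).2)
    rcases mul_eq_zero.1 h with h | h
    · exact hε0 h
    · exact (Real.rpow_pos_of_pos (lt_of_le_of_ne hnonneg (Ne.symm hbase)) _).ne' h
  have haff : ∀ x, a * x + b = a * (x - z) := fun x => by linear_combination hbase
  have ha : 0 < a := by
    obtain ⟨x, hx⟩ := Set.nonempty_Ioo.2 hzx
    have h := (hab x hx).1
    rw [haff] at h
    exact pos_of_mul_pos_left h (sub_pos.2 hx.1).le
  obtain ⟨k, hk⟩ := exists_nat_gt (1 / (1 - μ))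
  refine exists_nat_of_eq_rpow hI hz hzx k hk (C := ε * a ^ (1 / (1 - μ)))
    (mul_ne_zero hε0 (Real.rpow_pos_of_pos ha _).ne') hf fun x hx => ?_
  rw [(hab x hx).2, haff, Real.mul_rpow ha.le (sub_pos.2 hx.1).le, mul_assoc]

theorem exists_nat_of_zero_of_lt {I : Set ℝ} (hI : IsOpen I) (hIc : I.OrdConnected) {f : ℝ → ℝ}
    (hf : ContDiffOn ℝ ∞ f I) {μ : ℝ}
    (hode : ∀ x ∈ I, f x * deriv (deriv f) x = μ * deriv f x ^ 2) {z x₀ : ℝ} (hz : z ∈ I)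
    (hx₀ : x₀ ∈ I) (hzx : z < x₀) (hfz : f z = 0) (hfx₀ : f x₀ ≠ 0) :
    μ ≠ 1 ∧ ∃ n : ℕ, 1 / (1 - μ) = n := by
  have hIcc : Set.Icc z x₀ ⊆ I := hIc.out hz hx₀
  have hcomp : IsCompact (Set.Icc z x₀ ∩ f ⁻¹' {0}) :=
    isCompact_Icc.of_isClosed_subset ((hf.continuousOn.mono hIcc).preimage_isClosed_of_isClosed
      isClosed_Icc isClosed_singleton) Set.inter_subset_left
  -- the last zero before `x₀`
  obtain ⟨w, ⟨hw, hfw⟩, hmax⟩ := hcomp.exists_isGreatest ⟨z, ⟨le_rfl, hzx.le⟩, hfz⟩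
  have hwx : w < x₀ := lt_of_le_of_ne hw.2 fun h => hfx₀ (h ▸ hfw)
  refine exists_nat_of_zero_of_Ioo hI hf hode (hIcc hw) hwx
    (fun x hx => hIcc ⟨hw.1.trans hx.1.le, hx.2.le⟩) hfw fun x hx hfx => ?_
  exact absurd (hmax ⟨⟨hw.1.trans hx.1.le, hx.2.le⟩, hfx⟩) (not_le.2 hx.1)

/-- A smooth solution of `f f'' = μ f'²` with a zero which does not vanish identically has
`μ = 1 - 1 / n` for a natural number `n`. -/
theorem exists_nat_of_zero {I : Set ℝ} (hI : IsOpen I) (hIc : I.OrdConnected) {f : ℝ → ℝ}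
    (hf : ContDiffOn ℝ ∞ f I) {μ : ℝ}
    (hode : ∀ x ∈ I, f x * deriv (deriv f) x = μ * deriv f x ^ 2) {z x₀ : ℝ} (hz : z ∈ I)
    (hx₀ : x₀ ∈ I) (hfz : f z = 0) (hfx₀ : f x₀ ≠ 0) :
    μ ≠ 1 ∧ ∃ n : ℕ, 1 / (1 - μ) = n := by
  rcases lt_trichotomy z x₀ with h | h | h
  · exact exists_nat_of_zero_of_lt hI hIc hf hode hz hx₀ h hfz hfx₀
  · exact absurd (h ▸ hfz) hfx₀
  · -- reflect the interval
    have h1 : deriv (fun x => f (-x)) = fun x => -deriv f (-x) := funext fun x => deriv_comp_neg f x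
    refine exists_nat_of_zero_of_lt (I := Neg.neg ⁻¹' I) (f := fun x => f (-x)) (z := -z)
      (x₀ := -x₀) (hI.preimage continuous_neg) ?_ ?_ ?_ (by simpa using hz) (by simpa using hx₀)
      (neg_lt_neg h) (by simpa using hfz) (by simpa using hfx₀)
    · refine ⟨fun x hx y hy t ht => ?_⟩
      exact hIc.out hy hx ⟨neg_le_neg ht.2, neg_le_neg ht.1⟩
    · exact hf.comp contDiff_neg.contDiffOn fun x hx => hx
    · intro x hx
      have h2 : deriv (fun x => -deriv f (-x)) x = deriv (deriv f) (-x) := by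
        rw [deriv.fun_neg, deriv_comp_neg (deriv f) x, neg_neg]
      rw [h1, h2]
      simpa using hode (-x) hx

/-- A smooth function on an interval which is locally, near the points of a dense set, a polynomial
of degree less than `n`, and which vanishes near one point, vanishes identically. -/
theorem eq_zero_of_frequently_locally_polynomial {I : Set ℝ} (hI : IsOpen I)
    (hIp : IsPreconnected I) {x₀ : ℝ} (hx₀ : x₀ ∈ I) (n : ℕ) : ∀ {F : ℝ → ℝ},
      ContDiffOn ℝ ∞ F I → F =ᶠ[nhds x₀] 0 →
      (∀ x ∈ I, ∃ᶠ y in nhds x, ∃ P : Polynomial ℝ, P.degree < n ∧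
        F =ᶠ[nhds y] fun t => P.eval t) → ∀ x ∈ I, F x = 0 := by
  induction n with
  | zero =>
    intro F hF _ hP x hx
    have hfreq : ∃ᶠ y in nhds x, F y = 0 := by
      refine (hP x hx).mono ?_
      rintro y ⟨P, hdeg, hFP⟩
      have hP0 : P = 0 := by
        by_contra hne
        have := Polynomial.zero_le_degree_iff.2 hne
        exact absurd hdeg (not_lt.2 (by simpa using this))
      simpa [hP0] using hFP.eq_of_nhds
    by_contra hne
    exact hfreq ((hF.continuousOn.continuousAt (hI.mem_nhds hx)).eventually_ne hne)
  | succ n ih =>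
    intro F hF hF0 hP
    have hd : ∀ x ∈ I, deriv F x = 0 := by
      refine ih (contDiffOn_deriv hI hF) (by simpa using hF0.deriv) fun x hx => ?_
      refine (hP x hx).mono ?_
      rintro y ⟨P, hdeg, hFP⟩
      refine ⟨P.derivative, ?_, ?_⟩
      · by_cases hne : P = 0
        · simp [hne]
        · have h1 := Polynomial.degree_derivative_lt hne
          rw [Polynomial.degree_eq_natDegree hne] at h1 hdeg
          have h2 : P.natDegree < n + 1 := by exact_mod_cast hdeg
          exact lt_of_lt_of_le h1 (by exact_mod_cast Nat.lt_succ_iff.1 h2)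
      · filter_upwards [hFP.deriv] with t ht
        rw [ht]
        exact P.deriv
    obtain ⟨c, hc⟩ := hI.exists_is_const_of_deriv_eq_zero hIp
      (hF.differentiableOn (by simp)) hd
    intro x hx
    rw [hc x hx, ← hc x₀ hx₀, hF0.eq_of_nhds]
    rfl

/-- Smooth nonconstant solutions of `f f'' = μ f'²` on an interval with `μ ≠ 0, 1` are powers of
affine functions. Where the solution has zeros, the exponent is a positive integer and the local
solutions are polynomials, which fit together by smoothness. -/
theorem exists_eq_rpow {I : Set ℝ} (hI : IsOpen I) (hIc : I.OrdConnected) {f : ℝ → ℝ}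
    (hf : ContDiffOn ℝ ∞ f I) {μ : ℝ} (hμ0 : μ ≠ 0) (hμ : μ ≠ 1)
    (hode : ∀ x ∈ I, f x * deriv (deriv f) x = μ * deriv f x ^ 2) {x₀ : ℝ} (hx₀ : x₀ ∈ I)
    (hfx₀ : deriv f x₀ ≠ 0) :
    ∃ ε a b : ℝ, (ε = 1 ∨ ε = -1) ∧ a ≠ 0 ∧
      ∀ x ∈ I, PowMeaningful (a * x + b) (1 / (1 - μ)) ∧
        f x = ε * (a * x + b) ^ (1 / (1 - μ)) := by
  have hne₀ : f x₀ ≠ 0 := by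
    intro h
    have := hode x₀ hx₀
    rw [h, zero_mul] at this
    exact mul_ne_zero hμ0 (pow_ne_zero 2 hfx₀) this.symm
  -- around a point where `f ≠ 0`, the zero-free case applies
  have hloc : ∀ y ∈ I, f y ≠ 0 → ∃ ε a b : ℝ, (ε = 1 ∨ ε = -1) ∧
      ∀ᶠ x in nhds y, 0 < a * x + b ∧ f x = ε * (a * x + b) ^ (1 / (1 - μ)) := by
    intro y hy hfy
    have hev : ∀ᶠ x in nhds y, x ∈ I ∧ f x ≠ 0 := Filter.Eventually.and (hI.mem_nhds hy)
      ((hf.continuousOn.continuousAt (hI.mem_nhds hy)).eventually_ne hfy)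
    obtain ⟨r, hr, hball⟩ := Metric.eventually_nhds_iff_ball.1 hev
    obtain ⟨ε, a, b, hε, h⟩ := exists_eq_rpow_of_ne_zero Metric.isOpen_ball
      (convex_ball y r).isPreconnected (hf.mono fun x hx => (hball x hx).1) hμ
      (fun x hx => hode x (hball x hx).1) (fun x hx => (hball x hx).2)
    exact ⟨ε, a, b, hε, Filter.eventually_of_mem (Metric.ball_mem_nhds y hr) h⟩
  by_cases hne : ∀ x ∈ I, f x ≠ 0
  · obtain ⟨ε, a, b, hε, h⟩ := exists_eq_rpow_of_ne_zero hI hIc.isPreconnected hf hμ hode hne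
    refine ⟨ε, a, b, hε, ?_, fun x hx => ⟨Or.inl (h x hx).1, (h x hx).2⟩⟩
    rintro rfl
    have hc : f =ᶠ[nhds x₀] fun _ => ε * (0 * x₀ + b) ^ (1 / (1 - μ)) :=
      Filter.eventually_of_mem (hI.mem_nhds hx₀) fun x hx => by rw [(h x hx).2]; simp
    exact hfx₀ (by rw [hc.deriv_eq]; simp)
  push Not at hne
  obtain ⟨z, hz, hfz⟩ := hne
  obtain ⟨-, n, hn⟩ := exists_nat_of_zero hI hIc hf hode hz hx₀ hfz hne₀
  have hn0 : 0 < n := by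
    rcases Nat.eq_zero_or_pos n with h | h
    · rw [h, Nat.cast_zero] at hn
      exact absurd hn (one_div_ne_zero (sub_ne_zero.2 hμ.symm))
    · exact h
  simp only [hn, Real.rpow_natCast] at hloc ⊢
  obtain ⟨ε, a, b, hε, hab⟩ := hloc x₀ hx₀ hne₀
  have hdeg : ∀ c a b : ℝ,
      (Polynomial.C c * (Polynomial.C a * Polynomial.X + Polynomial.C b) ^ n).degree <
        ((n + 1 : ℕ) : WithBot ℕ) := by
    intro c a b
    refine Polynomial.degree_le_natDegree.trans_lt ?_
    refine Nat.cast_lt.2 (Nat.lt_succ_of_le ?_)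
    calc _ ≤ ((Polynomial.C a * Polynomial.X + Polynomial.C b) ^ n).natDegree :=
          Polynomial.natDegree_C_mul_le _ _
      _ ≤ n * (Polynomial.C a * Polynomial.X + Polynomial.C b).natDegree :=
          Polynomial.natDegree_pow_le
      _ ≤ n * 1 := Nat.mul_le_mul_left _ Polynomial.natDegree_linear_le
      _ = n := mul_one n
  have hF : ∀ x ∈ I, f x - ε * (a * x + b) ^ n = 0 := by
    refine eq_zero_of_frequently_locally_polynomial hI hIc.isPreconnected hx₀ (n + 1)
      (F := fun x => f x - ε * (a * x + b) ^ n) (hf.sub (by fun_prop)) ?_ ?_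
    · filter_upwards [hab] with x hx
      simp [hx.2]
    · intro x hx
      by_cases hfx : ∀ᶠ y in nhds x, f y = 0
      · refine hfx.eventually_nhds.frequently.mono fun y hy =>
          ⟨-(Polynomial.C ε * (Polynomial.C a * Polynomial.X + Polynomial.C b) ^ n), ?_, ?_⟩
        · rw [Polynomial.degree_neg]
          exact hdeg ε a b
        · filter_upwards [hy] with t ht
          simp [ht]
      · refine ((Filter.not_eventually.1 hfx).and_eventually (hI.mem_nhds hx)).mono ?_
        rintro y ⟨hfy, hy⟩
        obtain ⟨ε', a', b', -, hab'⟩ := hloc y hy hfy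
        refine ⟨Polynomial.C ε' * (Polynomial.C a' * Polynomial.X + Polynomial.C b') ^ n -
          Polynomial.C ε * (Polynomial.C a * Polynomial.X + Polynomial.C b) ^ n,
          (Polynomial.degree_sub_le _ _).trans_lt (max_lt (hdeg _ _ _) (hdeg _ _ _)), ?_⟩
        filter_upwards [hab'] with t ht
        simp [ht.2]
  refine ⟨ε, a, b, hε, ?_, fun x hx => ⟨Or.inr ⟨n, by simp, Or.inr (by exact_mod_cast hn0)⟩,
    by linarith [hF x hx]⟩⟩
  rintro rfl
  have h0 := hF z hz
  have h1 := hF x₀ hx₀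
  rw [hfz] at h0
  simp only [zero_mul] at h0 h1
  exact hne₀ (by linarith)

/-- Smooth nonconstant solutions of `f f'' = f'²` on an interval are exponentials. -/
theorem exists_eq_exp {I : Set ℝ} (hI : IsOpen I) (hIc : I.OrdConnected) {f : ℝ → ℝ}
    (hf : ContDiffOn ℝ ∞ f I)
    (hode : ∀ x ∈ I, f x * deriv (deriv f) x = 1 * deriv f x ^ 2) {x₀ : ℝ} (hx₀ : x₀ ∈ I)
    (hfx₀ : deriv f x₀ ≠ 0) :
    ∃ C k : ℝ, C ≠ 0 ∧ k ≠ 0 ∧ ∀ x ∈ I, f x = C * Real.exp (k * x) := by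
  have hne₀ : f x₀ ≠ 0 := by
    intro h
    have := hode x₀ hx₀
    rw [h, zero_mul, one_mul] at this
    exact pow_ne_zero 2 hfx₀ this.symm
  have hne : ∀ x ∈ I, f x ≠ 0 := fun z hz hfz =>
    (exists_nat_of_zero hI hIc hf hode hz hx₀ hfz hne₀).1 rfl
  obtain ⟨C, k, hC, h⟩ :=
    exists_eq_exp_of_ne_zero hI hIc.isPreconnected ⟨x₀, hx₀⟩ hf hode hne
  refine ⟨C, k, hC, ?_, h⟩
  rintro rfl
  have hc : f =ᶠ[nhds x₀] fun _ => C :=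
    Filter.eventually_of_mem (hI.mem_nhds hx₀) fun x hx => by simp [h x hx]
  exact hfx₀ (by rw [hc.deriv_eq]; simp)

/-! ### Flat homothetical surfaces -/

/-- Rulings parallel to the `i`-th coordinate axis over a curve in the plane where the `i`-th
coordinate vanishes sweep out a cylinder. The curve is parametrized by its `j`-th coordinate, hence
regular. -/
theorem isCylindricalOverPlaneCurve_of_ruling {T R : Set ℝ} (hTo : IsOpen T)
    (hTc : T.OrdConnected) (hTn : T.Nonempty) (hRo : IsOpen R) (hRc : R.OrdConnected)
    (hRn : R.Nonempty) {α : ℝ → E3} (hα : ContDiffOn ℝ ∞ α T) {i j : Fin 3}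
    (hαi : ∀ t ∈ T, α t i = 0) (hαj : ∀ t ∈ T, α t j = t) :
    IsCylindricalOverPlaneCurve
      {p | ∃ t ∈ T, ∃ s ∈ R, p = α t + s • EuclideanSpace.single i (1 : ℝ)} := by
  let φ : E3 →ₗ[ℝ] ℝ := (EuclideanSpace.proj i : E3 →L[ℝ] ℝ).toLinearMap
  have hφ : ∀ v, φ v = v i := fun v => rfl
  have hsurj : LinearMap.range φ = ⊤ :=
    LinearMap.range_eq_top.2 fun c => ⟨EuclideanSpace.single i c, by simp [hφ]⟩
  refine ⟨T, R, α, (LinearMap.ker φ).toAffineSubspace, EuclideanSpace.single i 1, hTo, hTc, hTn,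
    hRo, hRc, hRn, hα, fun t ht h0 => ?_, ?_, fun t ht => ?_, ?_, rfl⟩
  · have hd : HasDerivAt α (deriv α t) t :=
      ((hα.differentiableOn (by simp)).differentiableAt (hTo.mem_nhds ht)).hasDerivAt
    have h1 := (EuclideanSpace.proj j : E3 →L[ℝ] ℝ).hasFDerivAt.comp_hasDerivAt t hd
    rw [h0, map_zero] at h1
    have h2 := h1.unique (HasDerivAt.congr_of_eventuallyEq (hasDerivAt_id t)
      (Filter.eventually_of_mem (hTo.mem_nhds ht) fun s hs => hαj s hs))
    exact zero_ne_one h2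
  · rw [Submodule.toAffineSubspace_direction]
    have h := LinearMap.finrank_range_add_finrank_ker φ
    rw [hsurj, finrank_top, Module.finrank_self, finrank_euclideanSpace_fin] at h
    omega
  · change α t ∈ LinearMap.ker φ
    rw [LinearMap.mem_ker, hφ, hαi t ht]
  · rw [Submodule.toAffineSubspace_direction, LinearMap.mem_ker, hφ]
    simp

theorem isCylindrical_of_left_const {I J : Set ℝ} (hIo : IsOpen I) (hIc : I.OrdConnected)
    (hIn : I.Nonempty) (hJo : IsOpen J) (hJc : J.OrdConnected) (hJn : J.Nonempty) {f g : ℝ → ℝ}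
    (hg : ContDiffOn ℝ ∞ g J) {c : ℝ} (hc : ∀ x ∈ I, f x = c) :
    IsCylindricalOverPlaneCurve (homotheticalSurface I J f g) := by
  convert! isCylindricalOverPlaneCurve_of_ruling hJo hJc hJn hIo hIc hIn
    (α := fun t => !₂[0, t, c * g t]) (i := 0) (j := 1) ?_ (fun t _ => rfl) (fun t _ => rfl)
    using 1
  · ext p
    constructor
    · rintro ⟨x, hx, y, hy, rfl⟩
      refine ⟨y, hy, x, hx, ?_⟩
      ext k
      fin_cases k <;> simp [homotheticalParam, hc x hx]
    · rintro ⟨y, hy, x, hx, rfl⟩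
      refine ⟨x, hx, y, hy, ?_⟩
      ext k
      fin_cases k <;> simp [homotheticalParam, hc x hx]
  · refine contDiffOn_euclidean.2 fun k => ?_
    fin_cases k
    · exact contDiffOn_const
    · exact contDiffOn_id
    · exact contDiffOn_const.mul hg

theorem isCylindrical_of_right_const {I J : Set ℝ} (hIo : IsOpen I) (hIc : I.OrdConnected)
    (hIn : I.Nonempty) (hJo : IsOpen J) (hJc : J.OrdConnected) (hJn : J.Nonempty) {f g : ℝ → ℝ}
    (hf : ContDiffOn ℝ ∞ f I) {c : ℝ} (hc : ∀ y ∈ J, g y = c) :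
    IsCylindricalOverPlaneCurve (homotheticalSurface I J f g) := by
  convert! isCylindricalOverPlaneCurve_of_ruling hIo hIc hIn hJo hJc hJn
    (α := fun t => !₂[t, 0, f t * c]) (i := 1) (j := 0) ?_ (fun t _ => rfl) (fun t _ => rfl)
    using 1
  · ext p
    constructor
    · rintro ⟨x, hx, y, hy, rfl⟩
      refine ⟨x, hx, y, hy, ?_⟩
      ext k
      fin_cases k <;> simp [homotheticalParam, hc y hy]
    · rintro ⟨x, hx, y, hy, rfl⟩
      refine ⟨x, hx, y, hy, ?_⟩
      ext k
      fin_cases k <;> simp [homotheticalParam, hc y hy]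
  · refine contDiffOn_euclidean.2 fun k => ?_
    fin_cases k
    · exact contDiffOn_id
    · exact contDiffOn_const
    · exact hf.mul contDiffOn_const

theorem theorem3 (I J : Set ℝ)
    (hIo : IsOpen I) (hIc : I.OrdConnected) (hIn : I.Nonempty)
    (hJo : IsOpen J) (hJc : J.OrdConnected) (hJn : J.Nonempty)
    (f g : ℝ → ℝ) (hf : ContDiffOn ℝ ∞ f I) (hg : ContDiffOn ℝ ∞ g J) (K : ℝ)
    (hK : ∀ x ∈ I, ∀ y ∈ J,
      ParamSurface.gaussCurvature (homotheticalParam f g) x y = K) :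
    K = 0 ∧
      (IsCylindricalOverPlaneCurve (homotheticalSurface I J f g) ∨
       (∃ a b c : ℝ, a ≠ 0 ∧ b ≠ 0 ∧ c ≠ 0 ∧
          ∀ x ∈ I, ∀ y ∈ J, f x * g y = a * Real.exp (b * x + c * y)) ∨
       (∃ ε b c d e m : ℝ, (ε = 1 ∨ ε = -1) ∧ b ≠ 0 ∧ c ≠ 0 ∧ m ≠ 0 ∧ m ≠ 1 ∧
          (∀ x ∈ I, PowMeaningful (b * x / m + d) m) ∧
          (∀ y ∈ J, PowMeaningful (c * y / (m - 1) + e) (1 - m)) ∧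
          ∀ x ∈ I, ∀ y ∈ J,
            f x * g y = ε * ((b * x / m + d) ^ m * (c * y / (m - 1) + e) ^ (1 - m)))) := by
  have heq := fun x hx y hy => hK x hx y hy ▸ curvature_equation hIo hf hJo hg hx hy
  obtain rfl : K = 0 := curvature_eq_zero hIo hIn hJo hJn hf hg heq
  refine ⟨rfl, ?_⟩
  by_cases hf0 : ∀ x ∈ I, deriv f x = 0
  · obtain ⟨c, hc⟩ := hIo.exists_is_const_of_deriv_eq_zero hIc.isPreconnected
      (hf.differentiableOn (by simp)) hf0
    exact Or.inl (isCylindrical_of_left_const hIo hIc hIn hJo hJc hJn hg hc)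
  by_cases hg0 : ∀ y ∈ J, deriv g y = 0
  · obtain ⟨c, hc⟩ := hJo.exists_is_const_of_deriv_eq_zero hJc.isPreconnected
      (hg.differentiableOn (by simp)) hg0
    exact Or.inl (isCylindrical_of_right_const hIo hIc hIn hJo hJc hJn hf hc)
  push Not at hf0 hg0
  obtain ⟨x₀, hx₀, hfx₀⟩ := hf0
  obtain ⟨y₀, hy₀, hgy₀⟩ := hg0
  right
  -- separation of variables
  have hsep : ∀ x ∈ I, ∀ y ∈ J, f x * deriv (deriv f) x * (g y * deriv (deriv g) y) =
      deriv f x ^ 2 * deriv g y ^ 2 := fun x hx y hy => by linear_combination heq x hx y hy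
  have hp : deriv f x₀ ^ 2 ≠ 0 := pow_ne_zero 2 hfx₀
  have hq : deriv g y₀ ^ 2 ≠ 0 := pow_ne_zero 2 hgy₀
  have hprod : f x₀ * deriv (deriv f) x₀ * (g y₀ * deriv (deriv g) y₀) ≠ 0 := by
    rw [hsep x₀ hx₀ y₀ hy₀]
    exact mul_ne_zero hp hq
  have hA : f x₀ * deriv (deriv f) x₀ ≠ 0 := left_ne_zero_of_mul hprod
  have hB : g y₀ * deriv (deriv g) y₀ ≠ 0 := right_ne_zero_of_mul hprod
  obtain ⟨μ, hμ⟩ : ∃ μ, μ = f x₀ * deriv (deriv f) x₀ / deriv f x₀ ^ 2 := ⟨_, rfl⟩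
  have hμ0 : μ ≠ 0 := hμ ▸ div_ne_zero hA hp
  have hodeg : ∀ y ∈ J, g y * deriv (deriv g) y = μ⁻¹ * deriv g y ^ 2 := by
    intro y hy
    rw [hμ, inv_div, div_mul_eq_mul_div, eq_div_iff hA]
    linear_combination hsep x₀ hx₀ y hy
  have hodef : ∀ x ∈ I, f x * deriv (deriv f) x = μ * deriv f x ^ 2 := by
    intro x hx
    have h := hsep x hx y₀ hy₀
    rw [hodeg y₀ hy₀] at h
    field_simp at h
    linear_combination h
  by_cases hμ1 : μ = 1
  · left
    rw [hμ1] at hodef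
    rw [hμ1, inv_one] at hodeg
    obtain ⟨C, k, hC, hk, hfe⟩ := exists_eq_exp hIo hIc hf hodef hx₀ hfx₀
    obtain ⟨D, l, hD, hl, hge⟩ := exists_eq_exp hJo hJc hg hodeg hy₀ hgy₀
    refine ⟨C * D, k, l, mul_ne_zero hC hD, hk, hl, fun x hx y hy => ?_⟩
    rw [hfe x hx, hge y hy, Real.exp_add]
    ring
  · right
    have hμ1' : 1 - μ ≠ 0 := sub_ne_zero.2 (Ne.symm hμ1)
    have hμ1'' : μ - 1 ≠ 0 := sub_ne_zero.2 hμ1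
    obtain ⟨ε, a, b, hε, ha, hfe⟩ := exists_eq_rpow hIo hIc hf hμ0 hμ1 hodef hx₀ hfx₀
    obtain ⟨ε', a', b', hε', ha', hge⟩ := exists_eq_rpow hJo hJc hg (inv_ne_zero hμ0)
      (fun h => hμ1 (inv_eq_one.1 h)) hodeg hy₀ hgy₀
    obtain ⟨m, hm⟩ : ∃ m, m = 1 / (1 - μ) := ⟨_, rfl⟩
    -- the exponents attached to `μ` and `μ⁻¹` add up to `1`
    have hm' : 1 / (1 - μ⁻¹) = 1 - m := by
      rw [hm]
      field_simp
      ring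
    have hm0 : m ≠ 0 := hm ▸ one_div_ne_zero hμ1'
    have hm1 : m - 1 ≠ 0 := by
      rw [show m - 1 = μ / (1 - μ) by rw [hm]; field_simp; ring]
      exact div_ne_zero hμ0 hμ1'
    rw [← hm] at hfe
    rw [hm'] at hge
    have hb : ∀ x, a * m * x / m + b = a * x + b := fun x => by field_simp
    have hb' : ∀ y, a' * (m - 1) * y / (m - 1) + b' = a' * y + b' := fun y => by field_simp
    refine ⟨ε * ε', a * m, a' * (m - 1), b, b', m, ?_, mul_ne_zero ha hm0, mul_ne_zero ha' hm1,
      hm0, sub_ne_zero.1 hm1, fun x hx => ?_, fun y hy => ?_, fun x hx y hy => ?_⟩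
    · rcases hε with rfl | rfl <;> rcases hε' with rfl | rfl <;> simp
    · rw [hb]
      exact (hfe x hx).1
    · rw [hb']
      exact (hge y hy).1
    · rw [hb, hb', (hfe x hx).2, (hge y hy).2]
      ring
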